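/- Let $\beta_c=\log 4$, and for $\beta>0$ let $K(\beta)=(e^{\beta}+2)/(4\beta)$. For $\beta,K>0$ and $t,x\in\mathbb R$ put $$c_\beta(t)=\log\frac{1+e^{-\beta}(e^{t}+e^{-t})}{1+2e^{-\beta}},\qquad G_{\beta,K}(x)=\beta Kx^2-c_\beta(2\beta Kx).$$ For $x\in[-1,1]$ let $J_\beta(x)=\sup_{t\in\mathbb R}\{tx-c_\beta(t)\}$ and $I_{\beta,K}(x)=J_\beta(x)-\beta Kx^2-\inf_{y\in[-1,1]}\{J_\beta(y)-\beta Ky^2\}$. Let $\mathcal M_{\beta,K}=\{x\in[-1,1]: I_{\beta,K}(x)=0\}$ be the set of equilibrium values of the magnetization in the mean-field Blume-Capel model, and let $m(\beta,K)$ denote the unique positive element of $\mathcal M_{\beta,K}$ whenever there is exactly one. **Theorem 5.1.** Let $\alpha>0$, $b\in\{1,0,-1\}$ and $k\in\mathbb R$ with $k\neq K'(\beta_c)b$. Define $$\beta_n=\beta_c+\frac{b}{n^\alpha},\qquad K_n=K(\beta_c)+\frac{k}{n^\alpha},\qquad c_6=\frac{9}{40},\qquad g(x)=\beta_c\,(K'(\beta_c)b-k)\,x^2+c_6x^6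 .$$ Then $(\beta_n,K_n)\to(\beta_c,K(\beta_c))$ as $n\to\infty$, and the following hold. (a) $n^{3\alpha/2}\,G_{\beta_n,K_n}(x/n^{\alpha/4})\to g(x)$ as $n\to\infty$, uniformly for $x$ in compact subsets of $\mathbb R$. (b) The polynomial $g$ has nonzero global minimum points if and only if $K'(\beta_c)b-k<0$. If this inequality holds, then the global minimum points of $g$ are exactly $\pm\bar x$, where $$\bar x=\left(\frac{\beta_c\,(k-K'(\beta_c)b)}{3c_6}\right)^{1/4}.$$ (c) Assume that $K'(\beta_c)b-k<0$. Then for all sufficiently large $n$ we have $\beta_n,K_n>0$, $m(\beta_n,K_n)>0$ is well defined, $\mathcal M_{\beta_n,K_n}=\{\pm m(\beta_n,K_n)\}$, and this set is also the set of global minimum points of $G_{\beta_n,K_n}$ on $\mathbb R$. Moreover $m(\beta_n,K_n)\to0$ and $$\lim_{n\to\infty}n^{\alpha/4}\,m(\beta_n,K_n)=\bar x,\qquad\text{i.e. } m(\beta_n,K_n)\sim \bar x/n^{\alpha/4}.$$ If $b\neq0$, then also $\lim_{n\to\infty}|\beta_c-\beta_n|^{-1/4}\,m(\beta_n,K_n)=\bar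 x$, i.e. $m(\beta_n,K_n)\sim\bar x\,|\beta_c-\beta_n|^{1/4}$. -/

import Mathlib

open Filter Topology

namespace BlumeCapel

noncomputable section

/-- The cumulant generating function of the single-spin law on `{-1, 0, 1}` that is
proportional to `exp (-β ω²)`. -/
def cgfSpin (β t : ℝ) : ℝ :=
  Real.log ((1 + Real.exp (-β) * (Real.exp t + Real.exp (-t))) / (1 + 2 * Real.exp (-β)))

/-- The Legendre-Fenchel transform of `cgfSpin β`; used only for `x ∈ [-1, 1]`, where the
supremum is finite. -/
def cramerRate (β x : ℝ) : ℝ := ⨆ t : ℝ, (t * x - cgfSpin β t)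

/-- The rate function of the spin per site under the canonical ensemble, for `x ∈ [-1, 1]`. -/
def rate (β K x : ℝ) : ℝ :=
  cramerRate β x - β * K * x ^ 2
    - ⨅ y : Set.Icc (-1 : ℝ) 1, (cramerRate β (y : ℝ) - β * K * (y : ℝ) ^ 2)

/-- The set of equilibrium values of the magnetization: the zeros of the rate function. -/
def equilibria (β K : ℝ) : Set ℝ := {x | x ∈ Set.Icc (-1 : ℝ) 1 ∧ rate β K x = 0}

/-- The free-energy functional. -/
def freeEnergy (β K x : ℝ) : ℝ := β * K * x ^ 2 - cgfSpin β (2 * β * K * x)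

/-- The set of global minimum points of a real function. -/
def globalMinPoints (f : ℝ → ℝ) : Set ℝ := {x | ∀ y, f x ≤ f y}

open Classical in
/-- The magnetization: the unique positive equilibrium value (with default value `0` where there
is no such unique value). -/
def magnetization (β K : ℝ) : ℝ :=
  if h : ∃! m : ℝ, 0 < m ∧ m ∈ equilibria β K then h.choose else 0

/-- The curve `K(β)`: the second-order curve for `β < log 4`, the spinodal curve beyond. -/
def Kcurve (β : ℝ) : ℝ := (Real.exp β + 2) / (4 * β)

/-- The critical inverse temperature. -/
def βc : ℝ := Real.log 4

/-- The sequence of inverse temperatures. -/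
def βseq (α b : ℝ) (n : ℕ) : ℝ := βc + b / (n : ℝ) ^ α

/-- The sequence of interaction strengths. -/
def Kseq (α k : ℝ) (n : ℕ) : ℝ := Kcurve βc + k / (n : ℝ) ^ α

/-- The coefficient of the sixth-order term. -/
def c6 : ℝ := 9 / 40

/-- The Ginzburg-Landau polynomial. -/
def glPoly (b k x : ℝ) : ℝ := βc * (deriv Kcurve βc * b - k) * x ^ 2 + c6 * x ^ 6

/-- The positive global minimum point of the Ginzburg-Landau polynomial. -/
def xbar (b k : ℝ) : ℝ := (βc * (k - deriv Kcurve βc * b) / (3 * c6)) ^ (1 / 4 : ℝ)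

end

end BlumeCapel

namespace BlumeCapel

/-! ### Taylor expansion of the cumulant generating function -/

/-! With variance `p = 2 / (e^β + 2)`, `c_β(t) = log (1 + p (cosh t - 1))` is even, with a
sixth-order Taylor polynomial and an `O(t^8)` error uniform in `β`. Put `z = n^(α/4)`. In `z^6
G(x/z)` the quadratic coefficient is multiplied by `z^4 = n^α` and vanishes at rate `n^(-α)`,
because `K(β) = 1/(2βp)`. The quartic one is multiplied by `z^2` and contains the factor `p (1 -
3p)`, which is zero at `β_c`. The sextic one tends to `c₆`, and the remainder is `O(z^(-2))`. This
gives (a).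

For (c), Legendre duality (`equilibria_eq_globalMinPoints`) turns equilibrium values into minimizers
of `G`. When `K > K(β)`, `G` strictly decreases and then strictly increases on the half-line
(`exists_unimodal_freeEnergy`), so its minimizers are exactly `±m`. The sign of `K'(β_c) b - k`
places `(β_n, K_n)` in this region eventually. Unimodality also makes pointwise convergence enough
to locate `m`: comparing `G` at `x̄/z` and at `u/z` decides on which side of `u` the number `z m`
lies, so no separate compactness argument is needed. -/

theorem abs_cosh_sub_taylor_le {t : ℝ} (ht : |t| ≤ 1) :
    |Real.cosh t - (1 + t ^ 2 / 2 + t ^ 4 / 24 + t ^ 6 / 720)| ≤ t ^ 8 / 100 := by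
  have h1 := Real.exp_bound ht (n := 8) (by norm_num)
  have h2 := Real.exp_bound (x := -t) (by rwa [abs_neg]) (n := 8) (by norm_num)
  have h8 : |t| ^ 8 = t ^ 8 := by
    rw [pow_abs, abs_of_nonneg (by positivity)]
  rw [abs_neg] at h2
  rw [h8] at h1 h2
  simp only [Finset.sum_range_succ, Finset.sum_range_zero, Nat.factorial] at h1 h2
  norm_num at h1 h2
  rw [Real.cosh_eq]
  rw [abs_le] at h1 h2 ⊢
  have h0 : 0 ≤ t ^ 8 := by positivity
  constructor <;> linarith [h1.1, h1.2, h2.1, h2.2]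

theorem abs_log_one_add_sub_le {v : ℝ} (h0 : 0 ≤ v) (h1 : v ≤ 3 / 4) :
    |Real.log (1 + v) - (v - v ^ 2 / 2 + v ^ 3 / 3)| ≤ 4 * v ^ 4 := by
  have h := Real.abs_log_sub_add_sum_range_le (x := -v)
    (by rw [abs_neg, abs_of_nonneg h0]; linarith) 3
  rw [abs_neg, abs_of_nonneg h0] at h
  simp only [Finset.sum_range_succ, Finset.sum_range_zero] at h
  -- The bound `v ≤ 3/4` gives `1/(1 - v) ≤ 4`.
  have h2 : v ^ (3 + 1) / (1 - v) ≤ 4 * v ^ 4 := by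
    rw [div_le_iff₀ (by linarith)]
    have h4 : 0 ≤ v ^ 4 := by positivity
    have := mul_nonneg h4 (sub_nonneg.2 h1)
    norm_num at this ⊢
    linarith
  refine le_trans (le_of_eq ?_) (h.trans h2)
  congr 1
  rw [sub_neg_eq_add]
  push_cast
  ring

/-- The variance of the single-spin law. -/
noncomputable def spinVar (β : ℝ) : ℝ := 2 / (Real.exp β + 2)

theorem spinVar_pos (β : ℝ) : 0 < spinVar β := by
  unfold spinVar; positivity

theorem spinVar_le_one (β : ℝ) : spinVar β ≤ 1 := by
  unfold spinVar
  rw [div_le_one (by positivity)]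
  linarith [Real.exp_pos β]

theorem cgfSpin_eq (β t : ℝ) :
    cgfSpin β t = Real.log (1 + spinVar β * (Real.cosh t - 1)) := by
  unfold cgfSpin spinVar
  congr 1
  have := Real.exp_pos β
  rw [Real.cosh_eq, Real.exp_neg β]
  field_simp
  ring

/-- The sixth-order Taylor polynomial of the cumulant generating function of a symmetric law on
`{-1, 0, 1}` with variance `p`. -/
noncomputable def cgfTaylor (p t : ℝ) : ℝ :=
  p / 2 * t ^ 2 + (p / 24 - p ^ 2 / 8) * t ^ 4 + (p / 720 - p ^ 2 / 48 + p ^ 3 / 24) * t ^ 6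

/-- Since `0 < p ≤ 1`, every error term is bounded independently of `β`; this is what allows `β` to
vary with `n`. The constant 10 is generous. -/
theorem abs_cgfSpin_sub_taylor_le (β : ℝ) {t : ℝ} (ht : |t| ≤ 1) :
    |cgfSpin β t - cgfTaylor (spinVar β) t| ≤ 10 * t ^ 8 := by
  rw [cgfSpin_eq]
  have hp0 := spinVar_pos β
  have hp1 := spinVar_le_one β
  set p := spinVar β
  have hc := abs_cosh_sub_taylor_le ht
  obtain ⟨r, hr⟩ : ∃ r, r = Real.cosh t - (1 + t ^ 2 / 2 + t ^ 4 / 24 + t ^ 6 / 720) := ⟨_, rfl⟩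
  obtain ⟨u, hu⟩ : ∃ u, u = t ^ 2 := ⟨_, rfl⟩
  have hu0 : 0 ≤ u := hu ▸ sq_nonneg t
  have hu1 : u ≤ 1 := by rw [hu]; exact (sq_le_one_iff_abs_le_one t).2 ht
  obtain ⟨q, hq⟩ : ∃ q, q = u / 2 + u ^ 2 / 24 + u ^ 3 / 720 := ⟨_, rfl⟩
  obtain ⟨w, hw⟩ : ∃ w, w = Real.cosh t - 1 := ⟨_, rfl⟩
  have hwq : w = q + r := by rw [hw, hr, hq, hu]; ring
  have hw0 : 0 ≤ w := by rw [hw]; linarith [Real.one_le_cosh t]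
  have e2 : t ^ 2 = u := hu.symm
  have e4 : t ^ 4 = u ^ 2 := by rw [hu]; ring
  have e6 : t ^ 6 = u ^ 3 := by rw [hu]; ring
  have e8 : t ^ 8 = u ^ 4 := by rw [hu]; ring
  rw [← hr, e8] at hc
  have hq0 : 0 ≤ q := by rw [hq]; positivity
  have hu2 : u ^ 2 ≤ u := by nlinarith
  have hu3 : u ^ 3 ≤ u := by nlinarith
  have hu41 : u ^ 4 ≤ u := by nlinarith
  have hu5 : u ^ 5 ≤ u ^ 4 := pow_le_pow_of_le_one hu0 hu1 (by norm_num)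
  have hu6 : u ^ 6 ≤ u ^ 4 := pow_le_pow_of_le_one hu0 hu1 (by norm_num)
  have hu7 : u ^ 7 ≤ u ^ 4 := pow_le_pow_of_le_one hu0 hu1 (by norm_num)
  have hu8 : u ^ 8 ≤ u ^ 4 := pow_le_pow_of_le_one hu0 hu1 (by norm_num)
  have hu9 : u ^ 9 ≤ u ^ 4 := pow_le_pow_of_le_one hu0 hu1 (by norm_num)
  have hu4 : 0 ≤ u ^ 4 := by positivity
  have hqu : q ≤ 3 / 5 * u := by rw [hq]; linarith
  have hwu : w ≤ 3 / 5 * u := by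
    rw [hwq, hq]; linarith [(abs_le.1 hc).2]
  have hv0 : 0 ≤ p * w := by positivity
  have hvu : p * w ≤ 3 / 5 * u := (mul_le_of_le_one_left hw0 hp1).trans hwu
  have hlog := abs_log_one_add_sub_le hv0 (by linarith)
  have hv4 : 4 * (p * w) ^ 4 ≤ u ^ 4 := by
    have := pow_le_pow_left₀ hv0 hvu 4
    rw [mul_pow] at this
    norm_num at this
    linarith
  have hp2 : p ^ 2 ≤ 1 := pow_le_one₀ hp0.le hp1
  have hp3 : p ^ 3 ≤ 1 := pow_le_one₀ hp0.le hp1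
  have hw1 : w ≤ 1 := by linarith
  have hq1 : q ≤ 1 := by linarith
  have hquad : |w + q| ≤ 2 := by rw [abs_of_nonneg (by positivity)]; linarith
  have hcub : |w ^ 2 + w * q + q ^ 2| ≤ 3 := by
    rw [abs_of_nonneg (by positivity)]; nlinarith
  have hA : |p * r - p ^ 2 / 2 * (r * (w + q)) + p ^ 3 / 3 * (r * (w ^ 2 + w * q + q ^ 2))|
      ≤ u ^ 4 := by
    have b1 : |p * r| ≤ u ^ 4 / 100 := by
      rw [abs_mul, abs_of_pos hp0]
      exact (mul_le_of_le_one_left (abs_nonneg _) hp1).trans hc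
    have b2 : |p ^ 2 / 2 * (r * (w + q))| ≤ 1 / 2 * (u ^ 4 / 100 * 2) := by
      rw [abs_mul, abs_mul, abs_of_nonneg (by positivity : 0 ≤ p ^ 2 / 2)]
      gcongr
    have b3 : |p ^ 3 / 3 * (r * (w ^ 2 + w * q + q ^ 2))| ≤ 1 / 3 * (u ^ 4 / 100 * 3) := by
      rw [abs_mul, abs_mul, abs_of_nonneg (by positivity : 0 ≤ p ^ 3 / 3)]
      gcongr
    rw [abs_le] at b1 b2 b3 ⊢
    constructor <;> linarith [b1.1, b1.2, b2.1, b2.2, b3.1, b3.2]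
  have hQ2 : |q ^ 2 - u ^ 2 / 4 - u ^ 3 / 24| ≤ u ^ 4 := by
    have e : q ^ 2 - u ^ 2 / 4 - u ^ 3 / 24
        = (1 / 576 + 1 / 720) * u ^ 4 + 1 / 8640 * u ^ 5 + 1 / 518400 * u ^ 6 := by
      rw [hq]; ring
    rw [e, abs_of_nonneg (by positivity)]
    linarith
  have hQ3 : |q ^ 3 - u ^ 3 / 8| ≤ u ^ 4 := by
    obtain ⟨e, he⟩ : ∃ e, e = 1 / 12 + u / 360 := ⟨_, rfl⟩
    have he0 : 0 ≤ e := by rw [he]; positivity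
    have he1 : e ≤ 1 := by rw [he]; linarith
    have hqe : q ^ 3 - u ^ 3 / 8 = u ^ 4 * ((3 * e + 3 * e ^ 2 * u + e ^ 3 * u ^ 2) / 8) := by
      rw [hq, he]; ring
    rw [hqe, abs_of_nonneg (by positivity)]
    refine mul_le_of_le_one_right hu4 ?_
    have h1 : e ^ 2 * u ≤ 1 := mul_le_one₀ (pow_le_one₀ he0 he1) hu0 hu1
    have h2 : e ^ 3 * u ^ 2 ≤ 1 :=
      mul_le_one₀ (pow_le_one₀ he0 he1) (by positivity) (pow_le_one₀ hu0 hu1)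
    linarith
  have hB : |-(p ^ 2 / 2) * (q ^ 2 - u ^ 2 / 4 - u ^ 3 / 24) + p ^ 3 / 3 * (q ^ 3 - u ^ 3 / 8)|
      ≤ u ^ 4 := by
    have b1 : |-(p ^ 2 / 2) * (q ^ 2 - u ^ 2 / 4 - u ^ 3 / 24)| ≤ 1 / 2 * u ^ 4 := by
      rw [abs_mul, abs_neg, abs_of_nonneg (by positivity : 0 ≤ p ^ 2 / 2)]
      gcongr
    have b2 : |p ^ 3 / 3 * (q ^ 3 - u ^ 3 / 8)| ≤ 1 / 3 * u ^ 4 := by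
      rw [abs_mul, abs_of_nonneg (by positivity : 0 ≤ p ^ 3 / 3)]
      gcongr
    rw [abs_le] at b1 b2 ⊢
    constructor <;> linarith [b1.1, b1.2, b2.1, b2.2]
  -- Three errors: truncating the logarithm, replacing `w = cosh t - 1` by its Taylor polynomial
  -- `q`, and dropping the terms of order `u^4` and higher in `q^2` and `q^3`.
  have key : Real.log (1 + p * w) - cgfTaylor p t
      = (Real.log (1 + p * w) - (p * w - (p * w) ^ 2 / 2 + (p * w) ^ 3 / 3))
        + (p * r - p ^ 2 / 2 * (r * (w + q)) + p ^ 3 / 3 * (r * (w ^ 2 + w * q + q ^ 2)))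
        + (-(p ^ 2 / 2) * (q ^ 2 - u ^ 2 / 4 - u ^ 3 / 24) + p ^ 3 / 3 * (q ^ 3 - u ^ 3 / 8)) := by
    unfold cgfTaylor
    rw [e2, e4, e6, hwq, hq]
    ring
  rw [← hw, key, e8]
  rw [abs_le] at hA hB hlog ⊢
  constructor <;> linarith [hA.1, hA.2, hB.1, hB.2, hlog.1, hlog.2]

/-! ### Convexity and Legendre duality -/

/-- The derivative of the cumulant generating function. -/
noncomputable def cgfDeriv (β t : ℝ) : ℝ := Real.sinh t / (Real.exp β / 2 + Real.cosh t)

theorem cgfSpin_eq' (β t : ℝ) :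
    cgfSpin β t = Real.log (Real.exp β / 2 + Real.cosh t) - Real.log (Real.exp β / 2 + 1) := by
  have h1 := Real.exp_pos β
  have h2 := Real.cosh_pos t
  rw [← Real.log_div (by positivity) (by positivity), cgfSpin_eq, spinVar]
  congr 1
  field_simp
  ring

theorem hasDerivAt_cgfSpin (β t : ℝ) : HasDerivAt (cgfSpin β) (cgfDeriv β t) t := by
  have h1 := Real.exp_pos β
  have h2 := Real.cosh_pos t
  have : HasDerivAt (fun t => Real.log (Real.exp β / 2 + Real.cosh t)
      - Real.log (Real.exp β / 2 + 1)) (cgfDeriv β t) t :=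
    (((Real.hasDerivAt_cosh t).const_add _).log (by positivity)).sub_const _
  exact this.congr_of_eventuallyEq (Eventually.of_forall fun t => cgfSpin_eq' β t)

theorem abs_cgfDeriv_lt_one (β t : ℝ) : |cgfDeriv β t| < 1 := by
  have h1 := Real.exp_pos β
  have h2 := Real.cosh_pos t
  unfold cgfDeriv
  rw [abs_div, abs_of_pos (by positivity : 0 < Real.exp β / 2 + Real.cosh t),
    div_lt_one (by positivity), abs_lt]
  have h3 := Real.cosh_add_sinh t
  have h4 := Real.cosh_sub_sinh t
  constructor <;> linarith [Real.exp_pos t, Real.exp_pos (-t)]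

/-- Jensen's inequality for the law tilted by `t₀`, whose mean is `μ = c'(t₀)`: bound each of the
three exponentials `e^y` below by `1 + y`; the terms linear in `d` cancel by the choice of `μ`. -/
theorem cgfSpin_tangent_le (β t₀ t : ℝ) :
    cgfSpin β t₀ + cgfDeriv β t₀ * (t - t₀) ≤ cgfSpin β t := by
  have h1 := Real.exp_pos β
  have h2 := Real.cosh_pos t₀
  have h3 := Real.cosh_pos t
  obtain ⟨a, ha⟩ : ∃ a, a = Real.exp β / 2 := ⟨_, rfl⟩
  have ha0 : 0 < a := by rw [ha]; positivity
  obtain ⟨μ, hμ⟩ : ∃ μ, μ = cgfDeriv β t₀ := ⟨_, rfl⟩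
  have hμ' : μ * (a + Real.cosh t₀) = Real.sinh t₀ := by
    rw [hμ, cgfDeriv, ha]; field_simp
  obtain ⟨d, hd⟩ : ∃ d, d = t - t₀ := ⟨_, rfl⟩
  rw [cgfSpin_eq', cgfSpin_eq', ← ha, ← hμ, ← hd]
  suffices h : Real.log (a + Real.cosh t₀) + μ * d ≤ Real.log (a + Real.cosh t) by linarith
  rw [Real.le_log_iff_exp_le (by positivity), Real.exp_add, Real.exp_log (by positivity)]
  have k1 := Real.add_one_le_exp (d - μ * d)
  have k2 := Real.add_one_le_exp (-d - μ * d)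
  have k3 := Real.add_one_le_exp (-(μ * d))
  have e1 : Real.exp t = Real.exp t₀ * Real.exp (d - μ * d) * Real.exp (μ * d) := by
    rw [← Real.exp_add, ← Real.exp_add, hd]; ring_nf
  have e2 : Real.exp (-t) = Real.exp (-t₀) * Real.exp (-d - μ * d) * Real.exp (μ * d) := by
    rw [← Real.exp_add, ← Real.exp_add, hd]; ring_nf
  have e3 : a = a * Real.exp (-(μ * d)) * Real.exp (μ * d) := by
    rw [mul_assoc, ← Real.exp_add]; simp
  have e4 : a + Real.cosh t = (a * Real.exp (-(μ * d)) + (Real.exp t₀ * Real.exp (d - μ * d)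
      + Real.exp (-t₀) * Real.exp (-d - μ * d)) / 2) * Real.exp (μ * d) := by
    rw [Real.cosh_eq, e1, e2]; linear_combination e3
  rw [e4]
  refine mul_le_mul_of_nonneg_right ?_ (Real.exp_pos _).le
  have l1 := mul_le_mul_of_nonneg_left k1 (Real.exp_pos t₀).le
  have l2 := mul_le_mul_of_nonneg_left k2 (Real.exp_pos (-t₀)).le
  have l3 := mul_le_mul_of_nonneg_left k3 ha0.le
  rw [Real.cosh_eq, Real.sinh_eq] at hμ'
  rw [Real.cosh_eq]
  linear_combination l3 + (l1 + l2) / 2 + d * hμ'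

/-- `cosh t ≥ e^|t|/2` makes `c_β` grow at least like `|t|`, which beats `t x` when `|x| ≤ 1`.
Without boundedness the real supremum would be the default value `0`. -/
theorem bddAbove_legendre (β : ℝ) {x : ℝ} (hx : x ∈ Set.Icc (-1 : ℝ) 1) :
    BddAbove (Set.range fun t : ℝ => t * x - cgfSpin β t) := by
  refine ⟨Real.log (Real.exp β / 2 + 1) + Real.log 2, ?_⟩
  rintro _ ⟨t, rfl⟩
  have h1 := Real.exp_pos β
  have h3 := Real.cosh_pos t
  have h4 : |t| - Real.log 2 ≤ Real.log (Real.exp β / 2 + Real.cosh t) := by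
    rw [Real.le_log_iff_exp_le (by positivity), Real.exp_sub, Real.exp_log (by norm_num),
      ← Real.cosh_abs, Real.cosh_eq]
    linarith [Real.exp_pos (-|t|)]
  have h5 : t * x ≤ |t| := by
    refine (le_abs_self _).trans ?_
    rw [abs_mul]
    exact mul_le_of_le_one_right (abs_nonneg _) (abs_le.2 hx)
  dsimp only
  rw [cgfSpin_eq']
  linarith

/-- Test the supremum at `t = 2βKx`. -/
theorem freeEnergy_le_cramerRate_sub (β K : ℝ) {x : ℝ} (hx : x ∈ Set.Icc (-1 : ℝ) 1) :
    freeEnergy β K x ≤ cramerRate β x - β * K * x ^ 2 := by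
  have := le_ciSup (bddAbove_legendre β hx) (2 * β * K * x)
  unfold freeEnergy cramerRate
  linarith

/-- The tangent line inequality says that the supremum is attained at `t` itself. -/
theorem cramerRate_cgfDeriv (β t : ℝ) :
    cramerRate β (cgfDeriv β t) = t * cgfDeriv β t - cgfSpin β t := by
  unfold cramerRate
  refine le_antisymm (ciSup_le fun s => ?_) ?_
  · linarith [cgfSpin_tangent_le β t s]
  · exact le_ciSup (bddAbove_legendre β (abs_le.1 (abs_cgfDeriv_lt_one β t).le)) t

theorem hasDerivAt_freeEnergy (β K x : ℝ) :
    HasDerivAt (freeEnergy β K)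
      (2 * β * K * (x - cgfDeriv β (2 * β * K * x))) x := by
  have h1 := (hasDerivAt_pow 2 x).const_mul (β * K)
  have h2 := (hasDerivAt_cgfSpin β (2 * β * K * x)).comp x
    ((hasDerivAt_id x).const_mul (2 * β * K))
  have h3 := h1.sub h2
  norm_num at h3
  refine h3.congr_deriv ?_
  ring

/-- A global minimum point of the free-energy functional is critical. -/
theorem cgfDeriv_eq_of_mem_globalMinPoints {β K x : ℝ} (h0 : β * K ≠ 0)
    (hx : x ∈ globalMinPoints (freeEnergy β K)) : cgfDeriv β (2 * β * K * x) = x := by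
  have hz := IsLocalMin.hasDerivAt_eq_zero (Eventually.of_forall fun y => hx y)
    (hasDerivAt_freeEnergy β K x)
  have : 2 * (β * K) * (x - cgfDeriv β (2 * β * K * x)) = 0 := by linear_combination hz
  have := (mul_eq_zero.1 this).resolve_left (mul_ne_zero two_ne_zero h0)
  linarith

/-- Legendre duality: if the free-energy functional attains its minimum, then the equilibrium
values of the magnetization are its global minimum points. -/
theorem equilibria_eq_globalMinPoints {β K : ℝ} (h0 : β * K ≠ 0)
    (hne : (globalMinPoints (freeEnergy β K)).Nonempty) :
    equilibria β K = globalMinPoints (freeEnergy β K) := by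
  -- At a minimizer `x = c'(2βKx)`, so `|x| < 1` and the test point `t = 2βKx` is optimal: the
  -- inequality between the two functionals becomes an equality.
  have hval : ∀ x ∈ globalMinPoints (freeEnergy β K),
      x ∈ Set.Icc (-1 : ℝ) 1 ∧ cramerRate β x - β * K * x ^ 2 = freeEnergy β K x := by
    intro x hx
    have hc := cgfDeriv_eq_of_mem_globalMinPoints h0 hx
    have h1 := cramerRate_cgfDeriv β (2 * β * K * x)
    have h2 := abs_cgfDeriv_lt_one β (2 * β * K * x)
    rw [hc] at h1 h2
    refine ⟨abs_le.1 h2.le, ?_⟩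
    rw [h1, freeEnergy]
    ring
  obtain ⟨m, hm⟩ := hne
  obtain ⟨hmI, hmv⟩ := hval m hm
  have hinf : (⨅ y : Set.Icc (-1 : ℝ) 1, (cramerRate β (y : ℝ) - β * K * (y : ℝ) ^ 2))
      = freeEnergy β K m := by
    have hlow : ∀ y : Set.Icc (-1 : ℝ) 1,
        freeEnergy β K m ≤ cramerRate β (y : ℝ) - β * K * (y : ℝ) ^ 2 :=
      fun y => (hm y).trans (freeEnergy_le_cramerRate_sub β K y.2)
    have : Nonempty (Set.Icc (-1 : ℝ) 1) := ⟨⟨m, hmI⟩⟩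
    refine le_antisymm ?_ (le_ciInf hlow)
    rw [← hmv]
    exact ciInf_le (f := fun y : Set.Icc (-1 : ℝ) 1 =>
      cramerRate β (y : ℝ) - β * K * (y : ℝ) ^ 2)
      ⟨freeEnergy β K m, by rintro _ ⟨y, rfl⟩; exact hlow y⟩ ⟨m, hmI⟩
  ext x
  constructor
  · rintro ⟨hxI, hx⟩ y
    rw [rate, hinf] at hx
    have := freeEnergy_le_cramerRate_sub β K hxI
    exact le_trans (by linarith) (hm y)
  · intro hx
    obtain ⟨hxI, hxv⟩ := hval x hx
    refine ⟨hxI, ?_⟩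
    rw [rate, hinf, hxv, le_antisymm (hx m) (hm x), sub_self]

/-! ### Unimodality of the free-energy functional beyond the spinodal curve -/

theorem hasDerivAt_cgfDeriv (β t : ℝ) :
    HasDerivAt (cgfDeriv β)
      ((1 + Real.exp β / 2 * Real.cosh t) / (Real.exp β / 2 + Real.cosh t) ^ 2) t := by
  have h1 := Real.exp_pos β
  have h2 := Real.cosh_pos t
  have h := (Real.hasDerivAt_sinh t).div ((Real.hasDerivAt_cosh t).const_add (Real.exp β / 2))
    (by positivity)
  refine h.congr_deriv ?_
  congr 1
  linear_combination Real.cosh_sq t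

/-- With `a = e^β/2` and `w = cosh t`, this compares `c''(t) = (1 + a w)/(a + w)^2` with `1/s`. The
quadratic is negative at `w = 1` and eventually positive, so it changes sign once on `[1, ∞)`. -/
theorem exists_sign_change_quadratic {a s : ℝ} (ha : 0 < a) (hs : 1 + a < s) :
    ∃ w₁ > 1, (∀ w, 1 ≤ w → w < w₁ → (a + w) ^ 2 < s * (1 + a * w)) ∧
      ∀ w, w₁ < w → s * (1 + a * w) < (a + w) ^ 2 := by
  have hs0 : 0 < s := by linarith
  obtain ⟨W, hW⟩ : ∃ W, W = 1 + s * (1 + a) := ⟨_, rfl⟩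
  have hsa : 0 < s * (1 + a) := by positivity
  have hW1 : 1 < W := by linarith
  have hQ1 : (a + 1) ^ 2 - s * (1 + a * 1) < 0 := by nlinarith
  have hQW : 0 < (a + W) ^ 2 - s * (1 + a * W) := by
    have e1 : s * (1 + a * W) ≤ (W - 1) * W := by
      rw [hW]; nlinarith
    nlinarith
  have hcont : ContinuousOn (fun w : ℝ => (a + w) ^ 2 - s * (1 + a * w)) (Set.Icc 1 W) := by
    fun_prop
  obtain ⟨w₁, ⟨hw1, -⟩, hw0⟩ := intermediate_value_Icc hW1.le hcont ⟨hQ1.le, hQW.le⟩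
  dsimp only at hw0
  have hlt : 1 < w₁ := by
    rcases hw1.lt_or_eq with h | h
    · exact h
    · rw [← h] at hw0; linarith
  have hf : ∀ w, (a + w) ^ 2 - s * (1 + a * w) = (w - w₁) * (w + w₁ + 2 * a - s * a) := by
    intro w; linear_combination hw0
  -- The value at `1` is negative and `1 - w₁ < 0`, so the cofactor is positive at `1`, hence on
  -- `[1, ∞)`.
  have hpos : 0 < 1 + w₁ + 2 * a - s * a := by
    rw [hf 1] at hQ1
    by_contra hc
    nlinarith [mul_nonneg (sub_nonneg.2 hlt.le) (sub_nonneg.2 (not_lt.1 hc))]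
  refine ⟨w₁, hlt, fun w h1 h2 => ?_, fun w h1 => ?_⟩
  · have := mul_pos (sub_pos.2 h2) (by linarith : 0 < w + w₁ + 2 * a - s * a)
    have := hf w
    linarith
  · have := mul_pos (sub_pos.2 h1) (by linarith : 0 < w + w₁ + 2 * a - s * a)
    have := hf w
    linarith

/-- `h(t) = c'(t) - t/s` vanishes at `0`, increases up to the point where `cosh t = w₁`, then
decreases, and becomes negative; so it has exactly one positive zero. -/
theorem exists_sign_change_cgfDeriv {β s : ℝ} (hs : 1 + Real.exp β / 2 < s) :
    ∃ T > 0, (∀ t, 0 < t → t < T → t / s < cgfDeriv β t) ∧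
      ∀ t, T < t → cgfDeriv β t < t / s := by
  have ha : 0 < Real.exp β / 2 := by positivity
  have hs0 : 0 < s := by linarith
  obtain ⟨w₁, hw1, hlow, hhigh⟩ := exists_sign_change_quadratic ha hs
  obtain ⟨h, hh⟩ : ∃ h : ℝ → ℝ, h = fun t => cgfDeriv β t - t / s := ⟨_, rfl⟩
  have hd : ∀ t, HasDerivAt h
      ((1 + Real.exp β / 2 * Real.cosh t) / (Real.exp β / 2 + Real.cosh t) ^ 2 - 1 / s) t := by
    intro t
    rw [hh]
    exact (hasDerivAt_cgfDeriv β t).sub ((hasDerivAt_id t).div_const s)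
  have hc : Continuous h := continuous_iff_continuousAt.2 fun t => (hd t).continuousAt
  obtain ⟨t₁, ht⟩ : ∃ t₁, t₁ = Real.arcosh w₁ := ⟨_, rfl⟩
  have ht1 : 0 < t₁ := ht ▸ Real.arcosh_pos hw1
  have hct : Real.cosh t₁ = w₁ := ht ▸ Real.cosh_arcosh hw1.le
  have hmono : StrictMonoOn h (Set.Icc 0 t₁) := by
    refine strictMonoOn_of_deriv_pos (convex_Icc _ _) hc.continuousOn fun t hti => ?_
    rw [interior_Icc] at hti
    have hcosh := Real.cosh_pos t
    rw [(hd t).deriv, sub_pos, div_lt_div_iff₀ hs0 (by positivity), one_mul, mul_comm _ s]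
    refine hlow _ (Real.one_le_cosh t) ?_
    rw [← hct, Real.cosh_lt_cosh, abs_of_pos hti.1, abs_of_pos ht1]
    exact hti.2
  have hanti : StrictAntiOn h (Set.Ici t₁) := by
    refine strictAntiOn_of_deriv_neg (convex_Ici _) hc.continuousOn fun t hti => ?_
    rw [interior_Ici] at hti
    have hcosh := Real.cosh_pos t
    rw [(hd t).deriv, sub_neg, div_lt_div_iff₀ (by positivity) hs0, one_mul, mul_comm _ s]
    refine hhigh _ ?_
    rw [← hct, Real.cosh_lt_cosh, abs_of_pos (ht1.trans hti), abs_of_pos ht1]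
    exact hti
  have hzero : h 0 = 0 := by simp [hh, cgfDeriv]
  have hpos : ∀ t, 0 < t → t ≤ t₁ → 0 < h t := by
    intro t h0 h1
    rw [← hzero]
    exact hmono ⟨le_rfl, ht1.le⟩ ⟨h0.le, h1⟩ h0
  -- Here `c' < 1 = s/s`.
  have hneg : h s < 0 := by
    have := (abs_lt.1 (abs_cgfDeriv_lt_one β s)).2
    simp only [hh, div_self hs0.ne']
    linarith
  have hts : t₁ < s := by
    by_contra hcon
    exact absurd (hpos s hs0 (not_lt.1 hcon)) hneg.not_gt
  obtain ⟨T, ⟨hT1, -⟩, hT0⟩ := intermediate_value_Icc' hts.le hc.continuousOn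
    ⟨hneg.le, (hpos t₁ ht1 le_rfl).le⟩
  refine ⟨T, ht1.trans_le hT1, fun t h0 hlt => ?_, fun t hlt => ?_⟩
  · have : 0 < h t := by
      rcases le_total t t₁ with h1 | h1
      · exact hpos t h0 h1
      · rw [← hT0]; exact hanti h1 hT1 hlt
    rw [hh] at this
    exact sub_pos.1 this
  · have : h t < 0 := by
      rw [← hT0]; exact hanti hT1 (hT1.trans hlt.le) hlt
    rw [hh] at this
    exact sub_neg.1 this

theorem cgfSpin_neg (β t : ℝ) : cgfSpin β (-t) = cgfSpin β t := by
  simp only [cgfSpin, neg_neg, add_comm]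

theorem freeEnergy_neg (β K x : ℝ) : freeEnergy β K (-x) = freeEnergy β K x := by
  unfold freeEnergy
  rw [mul_neg, cgfSpin_neg, neg_sq]

theorem freeEnergy_abs (β K x : ℝ) : freeEnergy β K |x| = freeEnergy β K x := by
  rcases abs_choice x with h | h <;> rw [h]
  exact freeEnergy_neg β K x

theorem exists_unimodal_freeEnergy {β K : ℝ} (hβ : 0 < β) (hK : Kcurve β < K) :
    ∃ m > 0, StrictAntiOn (freeEnergy β K) (Set.Icc 0 m) ∧
      StrictMonoOn (freeEnergy β K) (Set.Ici m) := by
  obtain ⟨s, hs⟩ : ∃ s, s = 2 * β * K := ⟨_, rfl⟩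
  -- `2βK(β) = 1 + e^β/2`, so `K > K(β)` is the condition `c''(0) > 1/s`.
  have hs1 : 1 + Real.exp β / 2 < s := by
    rw [Kcurve, div_lt_iff₀ (by positivity)] at hK
    rw [hs]; linarith
  have hs0 : 0 < s := by linarith [Real.exp_pos β]
  obtain ⟨T, hT, hlow, hhigh⟩ := exists_sign_change_cgfDeriv hs1
  have hd := hasDerivAt_freeEnergy β K
  rw [← hs] at hd
  have hc : Continuous (freeEnergy β K) :=
    continuous_iff_continuousAt.2 fun t => (hd t).continuousAt
  -- `G'(x) = s (x - c'(s x))`, so its sign changes where `s x = T`.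
  refine ⟨T / s, by positivity, ?_, ?_⟩
  · refine strictAntiOn_of_deriv_neg (convex_Icc _ _) hc.continuousOn fun x hx => ?_
    rw [interior_Icc] at hx
    rw [(hd x).deriv]
    have := hlow (s * x) (mul_pos hs0 hx.1) (by rw [mul_comm]; exact (lt_div_iff₀ hs0).1 hx.2)
    rw [mul_div_cancel_left₀ _ hs0.ne'] at this
    exact mul_neg_of_pos_of_neg hs0 (sub_neg.2 this)
  · refine strictMonoOn_of_deriv_pos (convex_Ici _) hc.continuousOn fun x hx => ?_
    rw [interior_Ici] at hx
    rw [(hd x).deriv]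
    have := hhigh (s * x) (by rw [mul_comm]; exact (div_lt_iff₀ hs0).1 hx)
    rw [mul_div_cancel_left₀ _ hs0.ne'] at this
    exact mul_pos hs0 (sub_pos.2 this)

theorem globalMinPoints_eq_of_unimodal {f : ℝ → ℝ} {m : ℝ} (hm : 0 < m)
    (habs : ∀ x, f |x| = f x) (hanti : StrictAntiOn f (Set.Icc 0 m))
    (hmono : StrictMonoOn f (Set.Ici m)) : globalMinPoints f = {m, -m} := by
  have hlt : ∀ y, 0 ≤ y → y ≠ m → f m < f y := by
    intro y hy hne
    rcases hne.lt_or_gt with h | h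
    · exact hanti ⟨hy, h.le⟩ ⟨hm.le, le_rfl⟩ h
    · exact hmono (Set.mem_Ici.2 le_rfl) h.le h
  have hle : ∀ y, f m ≤ f y := by
    intro y
    rw [← habs y]
    rcases eq_or_ne |y| m with h | h
    · rw [h]
    · exact (hlt _ (abs_nonneg y) h).le
  ext x
  simp only [globalMinPoints, Set.mem_ofPred_eq, Set.mem_insert_iff, Set.mem_singleton_iff]
  rw [← abs_eq hm.le]
  constructor
  · intro hx
    by_contra hne
    have := hlt _ (abs_nonneg x) hne
    rw [habs] at this
    exact absurd (hx m) this.not_ge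
  · intro hx y
    rw [← habs x, hx]
    exact hle y

theorem magnetization_eq {β K m : ℝ} (hm : 0 < m) (h : equilibria β K = {m, -m}) :
    magnetization β K = m := by
  have hex : ∃! m : ℝ, 0 < m ∧ m ∈ equilibria β K := by
    refine ⟨m, ⟨hm, by simp [h]⟩, ?_⟩
    rintro y ⟨hy0, hy⟩
    rw [h] at hy
    rcases hy with hy | hy
    · exact hy
    · rw [Set.mem_singleton_iff] at hy; linarith
  rw [magnetization, dif_pos hex]
  exact (hex.unique hex.choose_spec.1 ⟨hm, by simp [h]⟩)

/-- Beyond the curve `K(β)` the model has exactly two equilibrium values `±m(β, K)`, which are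
the global minimum points of the unimodal (on the half-line) free-energy functional. -/
theorem magnetization_spec {β K : ℝ} (hβ : 0 < β) (hK : Kcurve β < K) :
    0 < magnetization β K ∧
    equilibria β K = {magnetization β K, -magnetization β K} ∧
    globalMinPoints (freeEnergy β K) = equilibria β K ∧
    StrictAntiOn (freeEnergy β K) (Set.Icc 0 (magnetization β K)) ∧
    StrictMonoOn (freeEnergy β K) (Set.Ici (magnetization β K)) := by
  have hK0 : 0 < K := lt_trans (by unfold Kcurve; positivity) hK
  obtain ⟨m, hm, hanti, hmono⟩ := exists_unimodal_freeEnergy hβ hK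
  have hmin := globalMinPoints_eq_of_unimodal hm (freeEnergy_abs β K) hanti hmono
  have heq := equilibria_eq_globalMinPoints (mul_pos hβ hK0).ne' (by simp [hmin])
  have hmag := magnetization_eq hm (heq.trans hmin)
  rw [hmag]
  exact ⟨hm, heq.trans hmin, heq.symm, hanti, hmono⟩

/-! ### The Ginzburg-Landau polynomial -/

theorem βc_pos : 0 < βc := Real.log_pos (by norm_num)

theorem xbar_pos {b k : ℝ} (h : deriv Kcurve βc * b - k < 0) : 0 < xbar b k := by
  have := mul_pos βc_pos (by linarith : 0 < k - deriv Kcurve βc * b)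
  unfold xbar c6
  positivity

theorem xbar_pow_four {b k : ℝ} (h : deriv Kcurve βc * b - k < 0) :
    3 * c6 * xbar b k ^ 4 = βc * (k - deriv Kcurve βc * b) := by
  have h0 := mul_pos βc_pos (by linarith : 0 < k - deriv Kcurve βc * b)
  have hc : (0 : ℝ) < c6 := by norm_num [c6]
  rw [xbar, ← Real.rpow_mul_natCast (by positivity)]
  norm_num
  field_simp

/-- As a cubic in `x^2`, `g - g(x̄)` has a double root at `x̄^2`; the absence of a quartic term in
`g` forces the remaining root to be `-2 x̄^2`. -/
theorem glPoly_sub_xbar {b k : ℝ} (h : deriv Kcurve βc * b - k < 0) (x : ℝ) :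
    glPoly b k x - glPoly b k (xbar b k)
      = c6 * (x ^ 2 - xbar b k ^ 2) ^ 2 * (x ^ 2 + 2 * xbar b k ^ 2) := by
  unfold glPoly
  linear_combination (x ^ 2 - xbar b k ^ 2) * xbar_pow_four h

theorem glPoly_xbar_lt {b k : ℝ} (h : deriv Kcurve βc * b - k < 0) {x : ℝ}
    (hx : |x| ≠ xbar b k) : glPoly b k (xbar b k) < glPoly b k x := by
  have hp := xbar_pos h
  have hne : x ^ 2 - xbar b k ^ 2 ≠ 0 := by
    intro h0
    rw [sub_eq_zero, sq_eq_sq_iff_abs_eq_abs, abs_of_pos hp] at h0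
    exact hx h0
  rw [← sub_pos, glPoly_sub_xbar h]
  have : (0 : ℝ) < c6 := by norm_num [c6]
  have : 0 < (x ^ 2 - xbar b k ^ 2) ^ 2 := by positivity
  positivity

theorem glPoly_abs (b k x : ℝ) : glPoly b k |x| = glPoly b k x := by
  unfold glPoly
  rw [sq_abs, Even.pow_abs (by decide)]

theorem globalMinPoints_glPoly {b k : ℝ} (h : deriv Kcurve βc * b - k < 0) :
    globalMinPoints (glPoly b k) = {xbar b k, -xbar b k} := by
  ext x
  simp only [globalMinPoints, Set.mem_ofPred_eq, Set.mem_insert_iff, Set.mem_singleton_iff]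
  rw [← abs_eq (xbar_pos h).le]
  constructor
  · intro hx
    by_contra hne
    exact absurd (hx (xbar b k)) (glPoly_xbar_lt h hne).not_ge
  · intro hx y
    rw [← glPoly_abs b k x, hx]
    by_cases hy : |y| = xbar b k
    · rw [← glPoly_abs b k y, hy]
    · exact (glPoly_xbar_lt h hy).le

theorem exists_ne_zero_mem_globalMinPoints_iff (b k : ℝ) :
    (∃ x ∈ globalMinPoints (glPoly b k), x ≠ 0) ↔ deriv Kcurve βc * b - k < 0 := by
  constructor
  · rintro ⟨x, hx, hne⟩
    by_contra hneg
    -- With a nonnegative quadratic coefficient, `g(x) > 0 = g(0)` for every `x ≠ 0`.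
    have h1 : 0 ≤ βc * (deriv Kcurve βc * b - k) * x ^ 2 :=
      mul_nonneg (mul_nonneg βc_pos.le (not_lt.1 hneg)) (sq_nonneg x)
    have h2 : 0 < c6 * x ^ 6 := by
      have : 0 < x ^ 6 := Even.pow_pos (by decide) hne
      unfold c6
      positivity
    have h3 := hx 0
    simp only [glPoly] at h3
    norm_num at h3
    linarith
  · intro h
    exact ⟨xbar b k, by rw [globalMinPoints_glPoly h]; simp, (xbar_pos h).ne'⟩

/-! ### Convergence of the coefficients -/

theorem tendsto_natCast_rpow {α : ℝ} (hα : 0 < α) :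
    Tendsto (fun n : ℕ => (n : ℝ) ^ α) atTop atTop :=
  (tendsto_rpow_atTop hα).comp tendsto_natCast_atTop_atTop

theorem tendsto_const_add_div_rpow {α : ℝ} (hα : 0 < α) (c b : ℝ) :
    Tendsto (fun n : ℕ => c + b / (n : ℝ) ^ α) atTop (𝓝 c) := by
  simpa using ((tendsto_natCast_rpow hα).const_div_atTop b).const_add c

theorem tendsto_βseq {α : ℝ} (hα : 0 < α) (b : ℝ) : Tendsto (βseq α b) atTop (𝓝 βc) :=
  tendsto_const_add_div_rpow hα βc b

theorem tendsto_Kseq {α : ℝ} (hα : 0 < α) (k : ℝ) :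
    Tendsto (Kseq α k) atTop (𝓝 (Kcurve βc)) :=
  tendsto_const_add_div_rpow hα (Kcurve βc) k

/-- The directional form of the derivative along `b` avoids dividing by `b`, so `b = 0` needs no
separate case. -/
theorem tendsto_rpow_mul_comp_βseq_sub {α : ℝ} (hα : 0 < α) (b : ℝ) {f : ℝ → ℝ} {f' : ℝ}
    (hf : HasDerivAt f f' βc) :
    Tendsto (fun n : ℕ => (n : ℝ) ^ α * (f (βseq α b n) - f βc)) atTop (𝓝 (f' * b)) := by
  have h := (hf.hasFDerivAt.lim_real b).comp (tendsto_natCast_rpow hα)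
  simp only [ContinuousLinearMap.toSpanSingleton_apply, smul_eq_mul, mul_comm b] at h
  refine h.congr fun n => ?_
  simp only [Function.comp, βseq]
  rw [div_eq_inv_mul]

theorem differentiableAt_Kcurve {β : ℝ} (hβ : β ≠ 0) : DifferentiableAt ℝ Kcurve β := by
  unfold Kcurve
  have : 4 * β ≠ 0 := by positivity
  fun_prop (disch := assumption)

theorem differentiable_spinVar : Differentiable ℝ spinVar := by
  unfold spinVar
  intro β
  have : Real.exp β + 2 ≠ 0 := by positivity
  fun_prop (disch := assumption)

theorem exp_βc : Real.exp βc = 4 := Real.exp_log (by norm_num)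

theorem spinVar_βc : spinVar βc = 1 / 3 := by
  rw [spinVar, exp_βc]; norm_num

theorem Kcurve_pos {β : ℝ} (hβ : 0 < β) : 0 < Kcurve β := by
  unfold Kcurve; positivity

theorem two_mul_βc_mul_Kcurve : 2 * βc * Kcurve βc = 3 := by
  have := βc_pos
  rw [Kcurve, exp_βc]
  field_simp
  norm_num

theorem tendsto_two_mul_βseq_mul_Kseq {α : ℝ} (hα : 0 < α) (b k : ℝ) :
    Tendsto (fun n => 2 * βseq α b n * Kseq α k n) atTop (𝓝 3) := by
  rw [← two_mul_βc_mul_Kcurve]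
  exact ((tendsto_βseq hα b).const_mul 2).mul (tendsto_Kseq hα k)

theorem tendsto_rpow_mul_Kcurve_sub_Kseq {α : ℝ} (hα : 0 < α) (b k : ℝ) :
    Tendsto (fun n : ℕ => (n : ℝ) ^ α * (Kcurve (βseq α b n) - Kseq α k n)) atTop
      (𝓝 (deriv Kcurve βc * b - k)) := by
  have h := (tendsto_rpow_mul_comp_βseq_sub hα b
    (differentiableAt_Kcurve βc_pos.ne').hasDerivAt).sub_const k
  refine h.congr' ?_
  filter_upwards [eventually_gt_atTop 0] with n hn
  have : 0 < (n : ℝ) ^ α := Real.rpow_pos_of_pos (by exact_mod_cast hn) α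
  rw [Kseq]
  field_simp
  ring

/-- Since `K(β) = 1/(2βp)`, the coefficient equals `βK (K(β) - K)/K(β)`. -/
theorem tendsto_quadratic_coeff {α : ℝ} (hα : 0 < α) (b k : ℝ) :
    Tendsto (fun n : ℕ => (n : ℝ) ^ α * (βseq α b n * Kseq α k n
        - spinVar (βseq α b n) / 2 * (2 * βseq α b n * Kseq α k n) ^ 2)) atTop
      (𝓝 (βc * (deriv Kcurve βc * b - k))) := by
  have hK : Tendsto (fun n => Kcurve (βseq α b n)) atTop (𝓝 (Kcurve βc)) :=
    (differentiableAt_Kcurve βc_pos.ne').continuousAt.tendsto.comp (tendsto_βseq hα b)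
  have hKc := Kcurve_pos βc_pos
  have h := (((tendsto_βseq hα b).mul (tendsto_Kseq hα k)).div hK hKc.ne').mul
    (tendsto_rpow_mul_Kcurve_sub_Kseq hα b k)
  rw [mul_div_cancel_right₀ _ hKc.ne'] at h
  refine h.congr' ?_
  filter_upwards [(tendsto_βseq hα b).eventually_const_lt βc_pos] with n hn
  simp only [Pi.div_apply]
  have := Real.exp_pos (βseq α b n)
  rw [spinVar, Kcurve]
  field_simp
  ring

/-- `p/24 - p^2/8` vanishes at `p = 1/3`, so by differentiability it is `O(n^(-α))` along the
sequence, which outweighs `n^(α/2)`. -/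
theorem tendsto_quartic_coeff {α : ℝ} (hα : 0 < α) (b k : ℝ) :
    Tendsto (fun n : ℕ => (n : ℝ) ^ (α / 2) * ((spinVar (βseq α b n) / 24
        - spinVar (βseq α b n) ^ 2 / 8) * (2 * βseq α b n * Kseq α k n) ^ 4)) atTop (𝓝 0) := by
  have hd : DifferentiableAt ℝ (fun β => spinVar β / 24 - spinVar β ^ 2 / 8) βc := by
    have := differentiable_spinVar βc
    fun_prop
  have h1 := tendsto_rpow_mul_comp_βseq_sub hα b hd.hasDerivAt
  have h2 := tendsto_inv_atTop_zero.comp (tendsto_natCast_rpow (half_pos hα))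
  have h := (h2.mul h1).mul ((tendsto_two_mul_βseq_mul_Kseq hα b k).pow 4)
  rw [zero_mul, zero_mul] at h
  refine h.congr' ?_
  filter_upwards [eventually_gt_atTop 0] with n hn
  have hn0 : (0 : ℝ) < n := by exact_mod_cast hn
  have hpow : (n : ℝ) ^ α = (n : ℝ) ^ (α / 2) * (n : ℝ) ^ (α / 2) := by
    rw [← Real.rpow_add hn0, add_halves]
  have : 0 < (n : ℝ) ^ (α / 2) := Real.rpow_pos_of_pos hn0 _
  simp only [Function.comp, spinVar_βc, hpow]
  field_simp
  ring

/-- At `p = 1/3` the bracket is `-1/3240`, and `3^6/3240 = 9/40`. -/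
theorem tendsto_sextic_coeff {α : ℝ} (hα : 0 < α) (b k : ℝ) :
    Tendsto (fun n : ℕ => -((spinVar (βseq α b n) / 720 - spinVar (βseq α b n) ^ 2 / 48
        + spinVar (βseq α b n) ^ 3 / 24) * (2 * βseq α b n * Kseq α k n) ^ 6)) atTop
      (𝓝 c6) := by
  have hp : Tendsto (fun n => spinVar (βseq α b n)) atTop (𝓝 (1 / 3)) := by
    rw [← spinVar_βc]
    exact (differentiable_spinVar βc).continuousAt.tendsto.comp (tendsto_βseq hα b)
  have h := ((((hp.div_const 720).sub ((hp.pow 2).div_const 48)).add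
    ((hp.pow 3).div_const 24)).mul ((tendsto_two_mul_βseq_mul_Kseq hα b k).pow 6)).neg
  convert h using 2
  norm_num [c6]

/-! ### Convergence of the scaled free-energy functionals -/

theorem abs_freeEnergy_sub_taylor_le (β K : ℝ) {y : ℝ} (hy : |2 * β * K * y| ≤ 1) :
    |freeEnergy β K y - (β * K * y ^ 2 - cgfTaylor (spinVar β) (2 * β * K * y))|
      ≤ 10 * (2 * β * K * y) ^ 8 := by
  have h := abs_cgfSpin_sub_taylor_le β hy
  rw [← abs_neg] at h
  refine le_trans (le_of_eq ?_) h
  congr 1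
  rw [freeEnergy]
  ring

theorem tendstoUniformlyOn_scaled_freeEnergy {α : ℝ} (hα : 0 < α) (b k : ℝ) {C : Set ℝ}
    (hC : IsCompact C) :
    TendstoUniformlyOn (fun (n : ℕ) (x : ℝ) => (n : ℝ) ^ (3 * α / 2) *
      freeEnergy (βseq α b n) (Kseq α k n) (x / (n : ℝ) ^ (α / 4))) (glPoly b k) atTop C := by
  obtain ⟨M, hM, hCM⟩ := hC.isBounded.exists_pos_norm_le
  have hs := tendsto_two_mul_βseq_mul_Kseq hα b k
  have hz : Tendsto (fun n : ℕ => (n : ℝ) ^ (α / 4)) atTop atTop :=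
    tendsto_natCast_rpow (by positivity)
  have hA := tendsto_quadratic_coeff hα b k
  have hB := tendsto_quartic_coeff hα b k
  have hS := tendsto_sextic_coeff hα b k
  have hpow : ∀ (n : ℕ) (j : ℕ), ((n : ℝ) ^ (α / 4)) ^ j = (n : ℝ) ^ (α / 4 * j) := fun n j =>
    (Real.rpow_mul_natCast (Nat.cast_nonneg n) _ _).symm
  have e4 : ∀ n : ℕ, (n : ℝ) ^ α = ((n : ℝ) ^ (α / 4)) ^ 4 := fun n => by
    rw [hpow]; congr 1; push_cast; ring
  have e2 : ∀ n : ℕ, (n : ℝ) ^ (α / 2) = ((n : ℝ) ^ (α / 4)) ^ 2 := fun n => by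
    rw [hpow]; congr 1; push_cast; ring
  have e6 : ∀ n : ℕ, (n : ℝ) ^ (3 * α / 2) = ((n : ℝ) ^ (α / 4)) ^ 6 := fun n => by
    rw [hpow]; congr 1; push_cast; ring
  simp only [e4] at hA
  simp only [e2] at hB
  simp only [e6]
  have hsmall : Tendsto (fun n : ℕ => |2 * βseq α b n * Kseq α k n| * M / (n : ℝ) ^ (α / 4))
      atTop (𝓝 0) := (hs.abs.mul_const M).div_atTop hz
  have hR : Tendsto (fun n : ℕ => 10 * ((2 * βseq α b n * Kseq α k n) ^ 8 * M ^ 8) /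
      ((n : ℝ) ^ (α / 4)) ^ 2) atTop (𝓝 0) :=
    (((hs.pow 8).mul_const (M ^ 8)).const_mul 10).div_atTop
      ((tendsto_pow_atTop two_ne_zero).comp hz)
  -- A null sequence independent of `x` that dominates the error on `|x| ≤ M`.
  have htotal := ((((hA.sub_const (βc * (deriv Kcurve βc * b - k))).abs.mul_const (M ^ 2)).add
    (hB.abs.mul_const (M ^ 4))).add ((hS.sub_const c6).abs.mul_const (M ^ 6))).add hR
  simp only [sub_self, abs_zero, zero_mul, add_zero] at htotal
  rw [Metric.tendstoUniformlyOn_iff]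
  intro ε hε
  filter_upwards [htotal.eventually_lt_const hε, hsmall.eventually_le_const zero_lt_one,
    hz.eventually_gt_atTop 0] with n hn hn1 hn0 x hx
  refine lt_of_le_of_lt ?_ hn
  have hxM : |x| ≤ M := hCM x hx
  -- From here `n` is fixed and only algebra in `z`, `β`, `K`, `x` remains.
  clear hn hR hsmall htotal hA hB hS hs hz e2 e4 e6 hpow
  generalize (n : ℝ) ^ (α / 4) = z at *
  generalize βseq α b n = β at *
  generalize Kseq α k n = K at *
  have hxj : ∀ j : ℕ, |x ^ j| ≤ M ^ j := fun j => by
    rw [abs_pow]; exact pow_le_pow_left₀ (abs_nonneg x) hxM j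
  have hy : |2 * β * K * (x / z)| ≤ 1 := by
    refine le_trans ?_ hn1
    rw [abs_mul, abs_div, abs_of_pos hn0, mul_div_assoc]
    gcongr
  have h := abs_freeEnergy_sub_taylor_le β K hy
  obtain ⟨r, hr⟩ : ∃ r, r = freeEnergy β K (x / z) - (β * K * (x / z) ^ 2
    - cgfTaylor (spinVar β) (2 * β * K * (x / z))) := ⟨_, rfl⟩
  have hG : freeEnergy β K (x / z) = (β * K * (x / z) ^ 2
    - cgfTaylor (spinVar β) (2 * β * K * (x / z))) + r := by rw [hr]; ring
  rw [← hr] at h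
  have hrz : |z ^ 6 * r| ≤ 10 * ((2 * β * K) ^ 8 * M ^ 8) / z ^ 2 := by
    have hx8 : x ^ 8 ≤ M ^ 8 := (le_abs_self _).trans (hxj 8)
    have h8 : 0 ≤ (2 * β * K) ^ 8 := Even.pow_nonneg (by decide) _
    rw [abs_mul, abs_of_pos (by positivity : 0 < z ^ 6)]
    calc z ^ 6 * |r| ≤ z ^ 6 * (10 * (2 * β * K * (x / z)) ^ 8) := by gcongr
      _ = 10 * ((2 * β * K) ^ 8 * x ^ 8) / z ^ 2 := by field_simp
      _ ≤ _ := by gcongr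
  rw [dist_comm, Real.dist_eq]
  generalize spinVar β = p at *
  have key : z ^ 6 * freeEnergy β K (x / z) - glPoly b k x
      = (z ^ 4 * (β * K - p / 2 * (2 * β * K) ^ 2) - βc * (deriv Kcurve βc * b - k)) * x ^ 2
        + -(z ^ 2 * ((p / 24 - p ^ 2 / 8) * (2 * β * K) ^ 4)) * x ^ 4
        + (-((p / 720 - p ^ 2 / 48 + p ^ 3 / 24) * (2 * β * K) ^ 6) - c6) * x ^ 6
        + z ^ 6 * r := by
    rw [hG, glPoly, cgfTaylor]
    field_simp
    ring
  rw [key]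
  refine (abs_add_le _ _).trans (add_le_add ((abs_add_le _ _).trans (add_le_add
    ((abs_add_le _ _).trans (add_le_add ?_ ?_)) ?_)) hrz)
  · rw [abs_mul]; exact mul_le_mul_of_nonneg_left (hxj 2) (abs_nonneg _)
  · rw [abs_mul, abs_neg]; exact mul_le_mul_of_nonneg_left (hxj 4) (abs_nonneg _)
  · rw [abs_mul]; exact mul_le_mul_of_nonneg_left (hxj 6) (abs_nonneg _)

theorem tendsto_scaled_freeEnergy {α : ℝ} (hα : 0 < α) (b k x : ℝ) :
    Tendsto (fun n : ℕ => (n : ℝ) ^ (3 * α / 2) *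
      freeEnergy (βseq α b n) (Kseq α k n) (x / (n : ℝ) ^ (α / 4))) atTop (𝓝 (glPoly b k x)) :=
  (tendstoUniformlyOn_scaled_freeEnergy hα b k isCompact_singleton).tendsto_at
    (Set.mem_singleton x)

/-! ### Asymptotics of the magnetization -/

theorem eventually_Kcurve_lt_Kseq {α : ℝ} (hα : 0 < α) {b k : ℝ}
    (h : deriv Kcurve βc * b - k < 0) :
    ∀ᶠ n : ℕ in atTop, 0 < βseq α b n ∧ Kcurve (βseq α b n) < Kseq α k n := by
  filter_upwards [(tendsto_βseq hα b).eventually_const_lt βc_pos,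
    (tendsto_rpow_mul_Kcurve_sub_Kseq hα b k).eventually_lt_const h] with n h1 h2
  refine ⟨h1, ?_⟩
  have := neg_of_mul_neg_right h2 (Real.rpow_nonneg (Nat.cast_nonneg n) α)
  linarith

/-- If `z m` were on the wrong side of `u`, then `u/z` and `x̄/z` would lie on the same monotone
branch of `G`, with `G(u/z) < G(x̄/z)`. The limit `g(x̄) < g(u)` excludes this for large `n`. -/
theorem tendsto_scaled_magnetization {α : ℝ} (hα : 0 < α) {b k : ℝ}
    (h : deriv Kcurve βc * b - k < 0) :
    Tendsto (fun n : ℕ => (n : ℝ) ^ (α / 4) * magnetization (βseq α b n) (Kseq α k n)) atTop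
      (𝓝 (xbar b k)) := by
  have hx := xbar_pos h
  have hz : Tendsto (fun n : ℕ => (n : ℝ) ^ (α / 4)) atTop atTop :=
    tendsto_natCast_rpow (by positivity)
  have hlt : ∀ x, 0 ≤ x → x ≠ xbar b k → ∀ᶠ n : ℕ in atTop,
      freeEnergy (βseq α b n) (Kseq α k n) (xbar b k / (n : ℝ) ^ (α / 4))
        < freeEnergy (βseq α b n) (Kseq α k n) (x / (n : ℝ) ^ (α / 4)) := by
    intro x hx0 hne
    filter_upwards [(tendsto_scaled_freeEnergy hα b k (xbar b k)).eventually_lt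
      (tendsto_scaled_freeEnergy hα b k x)
      (glPoly_xbar_lt h (by rwa [abs_of_nonneg hx0]))] with n hn
    exact lt_of_mul_lt_mul_left hn (Real.rpow_nonneg (Nat.cast_nonneg n) _)
  refine tendsto_order.2 ⟨fun u hu => ?_, fun u hu => ?_⟩
  -- Replacing `u` by `max u 0` avoids negative `u`, in particular `u = -x̄`, where `g` is again
  -- minimal.
  · have hv : max u 0 < xbar b k := max_lt hu hx
    filter_upwards [hlt (max u 0) (le_max_right _ _) hv.ne, eventually_Kcurve_lt_Kseq hα h,
      hz.eventually_gt_atTop 0] with n hn ⟨hβ, hK⟩ hn0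
    obtain ⟨-, -, -, -, hmono⟩ := magnetization_spec hβ hK
    refine (le_max_left u 0).trans_lt ?_
    by_contra hcon
    have hle := (le_div_iff₀' hn0).2 (not_lt.1 hcon)
    have hdiv : max u 0 / (n : ℝ) ^ (α / 4) < xbar b k / (n : ℝ) ^ (α / 4) := by gcongr
    exact (hmono (Set.mem_Ici.2 hle) (Set.mem_Ici.2 (hle.trans hdiv.le)) hdiv).not_gt hn
  · filter_upwards [hlt u (hx.trans hu).le hu.ne', eventually_Kcurve_lt_Kseq hα h,
      hz.eventually_gt_atTop 0] with n hn ⟨hβ, hK⟩ hn0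
    obtain ⟨-, -, -, hanti, -⟩ := magnetization_spec hβ hK
    by_contra hcon
    have hle := (div_le_iff₀' hn0).2 (not_lt.1 hcon)
    have hdiv : xbar b k / (n : ℝ) ^ (α / 4) < u / (n : ℝ) ^ (α / 4) := by gcongr
    exact (hanti ⟨by positivity, hdiv.le.trans hle⟩
      ⟨div_nonneg (hx.trans hu).le hn0.le, hle⟩ hdiv).not_gt hn

theorem tendsto_magnetization {α : ℝ} (hα : 0 < α) {b k : ℝ}
    (h : deriv Kcurve βc * b - k < 0) :
    Tendsto (fun n : ℕ => magnetization (βseq α b n) (Kseq α k n)) atTop (𝓝 0) := by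
  have hz : Tendsto (fun n : ℕ => (n : ℝ) ^ (α / 4)) atTop atTop :=
    tendsto_natCast_rpow (by positivity)
  refine ((tendsto_scaled_magnetization hα h).div_atTop hz).congr' ?_
  filter_upwards [hz.eventually_gt_atTop 0] with n hn0
  exact mul_div_cancel_left₀ _ hn0.ne'

theorem abs_βc_sub_βseq_rpow {b : ℝ} (hb : |b| = 1) (α : ℝ) (n : ℕ) :
    |βc - βseq α b n| ^ (-(1 / 4) : ℝ) = (n : ℝ) ^ (α / 4) := by
  have hn : (0 : ℝ) ≤ n := Nat.cast_nonneg n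
  rw [βseq, sub_add_cancel_left, abs_neg, abs_div, hb, abs_of_nonneg (Real.rpow_nonneg hn α),
    one_div, Real.inv_rpow (Real.rpow_nonneg hn α), Real.rpow_neg (Real.rpow_nonneg hn α),
    inv_inv, ← Real.rpow_mul hn, mul_one_div]

end BlumeCapel

theorem theorem5p1 (α b k : ℝ) (hα : 0 < α) (hb : b = 1 ∨ b = 0 ∨ b = -1)
    (hk : k ≠ deriv BlumeCapel.Kcurve BlumeCapel.βc * b) :
    -- convergence to the tricritical point
    Tendsto (fun n : ℕ => (BlumeCapel.βseq α b n, BlumeCapel.Kseq α k n)) atTop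
      (𝓝 (BlumeCapel.βc, BlumeCapel.Kcurve BlumeCapel.βc)) ∧
    -- (a) scaled free-energy functionals converge uniformly on compact sets
    (∀ C : Set ℝ, IsCompact C →
      TendstoUniformlyOn
        (fun (n : ℕ) (x : ℝ) => (n : ℝ) ^ (3 * α / 2) *
          BlumeCapel.freeEnergy (BlumeCapel.βseq α b n) (BlumeCapel.Kseq α k n)
            (x / (n : ℝ) ^ (α / 4)))
        (BlumeCapel.glPoly b k) atTop C) ∧
    -- (b) global minimum points of the Ginzburg-Landau polynomial
    ((∃ x ∈ BlumeCapel.globalMinPoints (BlumeCapel.glPoly b k), x ≠ 0) ↔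
      deriv BlumeCapel.Kcurve BlumeCapel.βc * b - k < 0) ∧
    (deriv BlumeCapel.Kcurve BlumeCapel.βc * b - k < 0 →
      BlumeCapel.globalMinPoints (BlumeCapel.glPoly b k)
        = {BlumeCapel.xbar b k, -BlumeCapel.xbar b k}) ∧
    -- (c) the magnetization is well defined for all large `n`, and its asymptotic behavior
    (deriv BlumeCapel.Kcurve BlumeCapel.βc * b - k < 0 →
      (∀ᶠ n : ℕ in atTop,
        0 < BlumeCapel.βseq α b n ∧ 0 < BlumeCapel.Kseq α k n ∧
        0 < BlumeCapel.magnetization (BlumeCapel.βseq α b n) (BlumeCapel.Kseq α k n) ∧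
        BlumeCapel.equilibria (BlumeCapel.βseq α b n) (BlumeCapel.Kseq α k n)
          = {BlumeCapel.magnetization (BlumeCapel.βseq α b n) (BlumeCapel.Kseq α k n),
             -BlumeCapel.magnetization (BlumeCapel.βseq α b n) (BlumeCapel.Kseq α k n)} ∧
        BlumeCapel.globalMinPoints
            (BlumeCapel.freeEnergy (BlumeCapel.βseq α b n) (BlumeCapel.Kseq α k n))
          = BlumeCapel.equilibria (BlumeCapel.βseq α b n) (BlumeCapel.Kseq α k n)) ∧
      Tendsto (fun n : ℕ =>
          BlumeCapel.magnetization (BlumeCapel.βseq α b n) (BlumeCapel.Kseq α k n))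
        atTop (𝓝 0) ∧
      Tendsto (fun n : ℕ => (n : ℝ) ^ (α / 4) *
          BlumeCapel.magnetization (BlumeCapel.βseq α b n) (BlumeCapel.Kseq α k n))
        atTop (𝓝 (BlumeCapel.xbar b k)) ∧
      (b ≠ 0 →
        Tendsto (fun n : ℕ => |BlumeCapel.βc - BlumeCapel.βseq α b n| ^ (-(1 / 4) : ℝ) *
            BlumeCapel.magnetization (BlumeCapel.βseq α b n) (BlumeCapel.Kseq α k n))
          atTop (𝓝 (BlumeCapel.xbar b k)))) := by
  refine ⟨(BlumeCapel.tendsto_βseq hα b).prodMk_nhds (BlumeCapel.tendsto_Kseq hα k),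
    fun C hC => BlumeCapel.tendstoUniformlyOn_scaled_freeEnergy hα b k hC,
    BlumeCapel.exists_ne_zero_mem_globalMinPoints_iff b k,
    BlumeCapel.globalMinPoints_glPoly, fun h => ⟨?_, BlumeCapel.tendsto_magnetization hα h,
      BlumeCapel.tendsto_scaled_magnetization hα h, fun hb0 => ?_⟩⟩
  · filter_upwards [BlumeCapel.eventually_Kcurve_lt_Kseq hα h] with n ⟨hβ, hK⟩
    obtain ⟨hm, heq, hmin, -, -⟩ := BlumeCapel.magnetization_spec hβ hK
    exact ⟨hβ, (BlumeCapel.Kcurve_pos hβ).trans hK, hm, heq, hmin⟩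
  · have hb1 : |b| = 1 := by
      rcases hb with rfl | rfl | rfl
      · simp
      · exact absurd rfl hb0
      · simp
    simp only [BlumeCapel.abs_βc_sub_βseq_rpow hb1]
    exact BlumeCapel.tendsto_scaled_magnetization hα h
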